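/- There is an absolute constant $c>0$ such that, for every finite set $A\subset\mathbb{R}\setminus\{0\}$, $$|AA+AA|\;\ge\; c\,|A|^{5/4}\,|A:A|^{1/3},$$ and in particular $$|AA+AA|\;\ge\; c\,|A|^{19/12}.$$ Here $AA+AA=\{a_1a_2+a_3a_4 : a_1,a_2,a_3,a_4\in A\}$, $A:A=\{a/b : a,b\in A\}$, and $|X|$ denotes the number of elements of a finite set $X$. -/

import Mathlib

open scoped Pointwise

/-! Write Q = |A:A| = q³. For every ratio u choose b(u) in A with b(u)u in A; multiples of (b(u),
b(u)u) by elements of A lie on the line of slope u, and sums of two of them lie in (AA+AA)². Up to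
constants, A may be replaced by a subset B of one sign and the ratios by a set R on which b has one
sign.

Two distinct slopes give |B|² sums. The sums from two different pairs of slopes share only O(|B|q²)
points: a shared point solves a three-term linear equation in B (`card_linear_solutions_le`), and
dilating by B turns solutions into incidences between lines and a grid, bounded by cutting the grid
into cells (`card_incidences_le`). By Cauchy–Schwarz, N slopes therefore yield at least a constant
times N²|B|² sums while N²q² = O(|B|) (`le_card_clusterSums`).

Clusters of N consecutive slopes occupy disjoint sectors, so about Q/N clusters give QN|B|² points
up to a constant. Taking N about √|B|/q gives |AA+AA|² ≫ q²|A|^(5/2). The second bound follows from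
Q ≥ |A|. -/

/-! ### Ranks and blocks of consecutive elements -/

/-- The number of elements of `V` below `v`. -/
noncomputable def rankIn (V : Finset ℝ) (v : ℝ) : ℕ := (V.filter (· < v)).card

theorem rankIn_mono (V : Finset ℝ) : Monotone (rankIn V) := fun a b h =>
  Finset.card_le_card fun x hx => by
    simp only [Finset.mem_filter] at hx ⊢
    exact ⟨hx.1, hx.2.trans_le h⟩

theorem rankIn_le (V : Finset ℝ) (v : ℝ) : rankIn V v ≤ V.card :=
  Finset.card_filter_le _ _

theorem rankIn_lt_of_lt {V : Finset ℝ} {a b : ℝ} (ha : a ∈ V) (h : a < b) :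
    rankIn V a < rankIn V b := by
  refine Finset.card_lt_card ((Finset.ssubset_iff_of_subset ?_).2 ⟨a, ?_, ?_⟩)
  · intro x hx
    simp only [Finset.mem_filter] at hx ⊢
    exact ⟨hx.1, hx.2.trans h⟩
  · simp [ha, h]
  · simp

theorem rankIn_injOn (V : Finset ℝ) : Set.InjOn (rankIn V) V := by
  intro a ha b hb h
  rcases lt_trichotomy a b with hab | hab | hab
  · exact absurd h (rankIn_lt_of_lt ha hab).ne
  · exact hab
  · exact absurd h (rankIn_lt_of_lt hb hab).ne'

theorem image_rankIn (V : Finset ℝ) : V.image (rankIn V) = Finset.range V.card := by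
  refine Finset.eq_of_subset_of_card_le ?_ ?_
  · intro i hi
    obtain ⟨v, hv, rfl⟩ := Finset.mem_image.1 hi
    refine Finset.mem_range.2 (Finset.card_lt_card ((Finset.ssubset_iff_of_subset
      (Finset.filter_subset _ _)).2 ⟨v, hv, by simp⟩))
  · rw [Finset.card_image_of_injOn (rankIn_injOn V), Finset.card_range]

theorem card_filter_rankIn_div (V : Finset ℝ) (t j : ℕ) :
    (V.filter fun v => rankIn V v / t = j).card =
      ((Finset.range V.card).filter fun i => i / t = j).card := by
  rw [← image_rankIn, Finset.filter_image,
    Finset.card_image_of_injOn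
      ((rankIn_injOn V).mono (Finset.coe_subset.2 (Finset.filter_subset _ _)))]

theorem filter_div_eq_subset_Ico {t : ℕ} (ht : 0 < t) (n j : ℕ) :
    ((Finset.range n).filter fun i => i / t = j) ⊆ Finset.Ico (j * t) (j * t + t) := by
  intro i hi
  simp only [Finset.mem_filter, Finset.mem_Ico] at hi ⊢
  obtain ⟨-, rfl⟩ := hi
  exact ⟨Nat.div_mul_le_self i t, Nat.lt_div_mul_add ht⟩

theorem card_block_le (V : Finset ℝ) {t : ℕ} (ht : 0 < t) (j : ℕ) :
    (V.filter fun v => rankIn V v / t = j).card ≤ t := by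
  rw [card_filter_rankIn_div]
  simpa using Finset.card_le_card (filter_div_eq_subset_Ico ht V.card j)

theorem card_block_eq (V : Finset ℝ) {t : ℕ} (ht : 0 < t) {j : ℕ} (hj : j < V.card / t) :
    (V.filter fun v => rankIn V v / t = j).card = t := by
  refine le_antisymm (card_block_le V ht j) ?_
  rw [card_filter_rankIn_div]
  have h : Finset.Ico (j * t) (j * t + t) ⊆
      (Finset.range V.card).filter fun i => i / t = j := by
    intro i hi
    simp only [Finset.mem_filter, Finset.mem_Ico, Finset.mem_range] at hi ⊢
    have h2 : (j + 1) * t ≤ V.card :=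
      (Nat.mul_le_mul_right t hj).trans (Nat.div_mul_le_self _ _)
    refine ⟨by nlinarith, ?_⟩
    rw [Nat.div_eq_iff ht]
    constructor <;> omega
  simpa using Finset.card_le_card h

/-! ### Incidences and linear equations -/

/-- A set is at most as large as the range of a map on it plus the number of its collisions. -/
theorem card_le_add_card_collisions (S : Finset ℝ) (φ : ℝ → ℕ) (M : ℕ)
    (hφ : ∀ u ∈ S, φ u < M) :
    S.card ≤ M + ((S ×ˢ S).filter fun p => p.1 ≠ p.2 ∧ φ p.1 = φ p.2).card := by
  classical
  rw [← Finset.card_filter_add_card_filter_not (s := S)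
    (fun u => ∀ w ∈ S, φ u = φ w → u = w)]
  refine add_le_add ?_ ?_
  · rw [← Finset.card_range M]
    refine Finset.card_le_card_of_injOn φ (fun u hu => ?_) (fun u hu w hw h => ?_)
    · have := (Finset.mem_filter.1 hu).1
      simpa using hφ u this
    · exact (Finset.mem_filter.1 hu).2 w (Finset.mem_filter.1 hw).1 h
  · refine (Finset.card_le_card (t := Finset.image Prod.fst
      ((S ×ˢ S).filter fun p => p.1 ≠ p.2 ∧ φ p.1 = φ p.2)) ?_).trans Finset.card_image_le
    intro u hu
    obtain ⟨hu, h⟩ := Finset.mem_filter.1 hu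
    push Not at h
    obtain ⟨w, hw, h1, h2⟩ := h
    exact Finset.mem_image.2 ⟨(u, w), by simp [hu, hw, h1, h2], rfl⟩

/-- Incidences between increasing lines `y = l.1 * x + l.2` and the grid `U ×ˢ V`, bounded by
cutting the grid into cells of size at most `s` by `t`. -/
theorem card_incidences_le (U V : Finset ℝ) (L : Finset (ℝ × ℝ)) (hL : ∀ l ∈ L, 0 < l.1)
    {s t : ℕ} (hs : 0 < s) (ht : 0 < t) :
    ((L ×ˢ U).filter fun p => p.1.1 * p.2 + p.1.2 ∈ V).card ≤
      L.card * (U.card / s + V.card / t + 1) + U.card * V.card * (s * t) := by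
  classical
  set h : ℝ → ℕ := fun u => rankIn U u / s with hh
  set g : ℝ → ℕ := fun v => rankIn V v / t with hg
  have hmono : Monotone h := fun a b hab => Nat.div_le_div_right (rankIn_mono U hab)
  have gmono : Monotone g := fun a b hab => Nat.div_le_div_right (rankIn_mono V hab)
  -- Pairs of distinct incidences of one line in one cell. Two points determine the line, so their
  -- number is at most that of pairs of grid points sharing a cell, whatever `L` is.
  set E : Finset ((ℝ × ℝ) × (ℝ × ℝ)) := (L ×ˢ (U ×ˢ U)).filter fun p =>
    p.1.1 * p.2.1 + p.1.2 ∈ V ∧ p.1.1 * p.2.2 + p.1.2 ∈ V ∧ p.2.1 ≠ p.2.2 ∧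
    h p.2.1 = h p.2.2 ∧ g (p.1.1 * p.2.1 + p.1.2) = g (p.1.1 * p.2.2 + p.1.2) with hE
  have hEle : E.card ≤ U.card * V.card * (s * t) := by
    let G : Finset ((ℝ × ℝ) × (ℝ × ℝ)) := (U ×ˢ V).biUnion fun p =>
      ((U.filter fun u => h u = h p.1) ×ˢ (V.filter fun v => g v = g p.2)).image fun w => (p, w)
    have hG : G.card ≤ U.card * V.card * (s * t) := by
      rw [← Finset.card_product]
      refine Finset.card_biUnion_le_card_mul _ _ _ fun p _ => Finset.card_image_le.trans ?_
      rw [Finset.card_product]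
      exact Nat.mul_le_mul (card_block_le U hs _) (card_block_le V ht _)
    refine le_trans ?_ hG
    refine Finset.card_le_card_of_injOn
      (fun p => ((p.2.1, p.1.1 * p.2.1 + p.1.2), (p.2.2, p.1.1 * p.2.2 + p.1.2))) ?_ ?_
    · rintro ⟨⟨m, c⟩, u, w⟩ hp
      simp only [hE, Finset.coe_filter, Finset.mem_product, Set.mem_ofPred_eq] at hp
      obtain ⟨⟨hl, hu, hw⟩, h1, h2, h3, h4, h5⟩ := hp
      simp only [G, Finset.coe_biUnion, Set.mem_iUnion, Finset.mem_coe, Finset.mem_image,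
        Finset.mem_product, Finset.mem_filter]
      exact ⟨(u, m * u + c), ⟨hu, h1⟩, (w, m * w + c), ⟨⟨hw, h4.symm⟩, h2, h5.symm⟩, rfl⟩
    · rintro ⟨⟨m, c⟩, u, w⟩ hp ⟨⟨m', c'⟩, u', w'⟩ hp' heq
      simp only [hE, Finset.coe_filter, Finset.mem_product, Set.mem_ofPred_eq] at hp
      have h3 : u ≠ w := hp.2.2.2.1
      simp only [Prod.mk.injEq] at heq
      obtain ⟨⟨rfl, e1⟩, rfl, e2⟩ := heq
      have hm : m = m' := by
        have : (m - m') * (u - w) = 0 := by linarith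
        rcases mul_eq_zero.1 this with h | h
        · linarith
        · exact absurd (by linarith) h3
      subst hm
      have : c = c' := by linarith
      subst this
      rfl
  have hI : ((L ×ˢ U).filter fun p => p.1.1 * p.2 + p.1.2 ∈ V).card =
      ∑ l ∈ L, (U.filter fun u => l.1 * u + l.2 ∈ V).card := by
    simp only [Finset.card_filter, Finset.sum_product]
  have hE2 : E.card = ∑ l ∈ L, ((U ×ˢ U).filter fun q =>
      l.1 * q.1 + l.2 ∈ V ∧ l.1 * q.2 + l.2 ∈ V ∧ q.1 ≠ q.2 ∧
      h q.1 = h q.2 ∧ g (l.1 * q.1 + l.2) = g (l.1 * q.2 + l.2)).card := by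
    simp only [hE, Finset.card_filter]
    rw [Finset.sum_product]
  rw [hI]
  refine le_trans ?_ (Nat.add_le_add_left hEle _)
  rw [hE2, ← smul_eq_mul (a := L.card), ← Finset.sum_const, ← Finset.sum_add_distrib]
  refine Finset.sum_le_sum fun l hl => ?_
  -- Along an increasing line both cell indices are monotone, so equality of their sums forces
  -- equality of each: the sum labels the cells met by the line.
  refine (card_le_add_card_collisions _ (fun u => h u + g (l.1 * u + l.2))
    (U.card / s + V.card / t + 1) ?_).trans (Nat.add_le_add_left (Finset.card_le_card ?_) _)
  · intro u _
    have h1 : h u ≤ U.card / s := Nat.div_le_div_right (rankIn_le U u)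
    have h2 : g (l.1 * u + l.2) ≤ V.card / t := Nat.div_le_div_right (rankIn_le V _)
    omega
  · rintro ⟨u, w⟩ hp
    simp only [Finset.mem_filter, Finset.mem_product] at hp ⊢
    obtain ⟨⟨⟨hu, hu'⟩, hw, hw'⟩, hne, heq⟩ := hp
    have hpos := hL l hl
    refine ⟨⟨hu, hw⟩, hu', hw', hne, ?_⟩
    rcases le_total u w with huw | huw
    · have h1 := hmono huw
      have h2 : g (l.1 * u + l.2) ≤ g (l.1 * w + l.2) := gmono (by gcongr)
      omega
    · have h1 := hmono huw
      have h2 : g (l.1 * w + l.2) ≤ g (l.1 * u + l.2) := gmono (by gcongr)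
      omega

/-- Few solutions of a linear equation in three variables from a set with few ratios. -/
theorem card_linear_solutions_le (B : Finset ℝ) (hB : ∀ x ∈ B, ∀ y ∈ B, 0 < x * y)
    {α β q : ℝ} (hα : α ≠ 0) (hβ : β ≠ 0) (hq : 1 ≤ q) (hQ : ((B / B).card : ℝ) ≤ q ^ 3) :
    ((((B ×ˢ B).filter fun p => α * p.1 + β * p.2 ∈ B).card : ℕ) : ℝ) ≤ 8 * B.card * q ^ 2 := by
  classical
  set T := (B ×ˢ B).filter fun p => α * p.1 + β * p.2 ∈ B with hT
  rcases B.eq_empty_or_nonempty with rfl | ⟨b, hb⟩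
  · simp [hT]
  have hn : (0 : ℝ) < B.card := by exact_mod_cast Finset.card_pos.2 ⟨b, hb⟩
  have hTn : (T.card : ℝ) ≤ B.card * B.card := by
    have : T.card ≤ B.card * B.card := by
      rw [← Finset.card_product]; exact Finset.card_filter_le _ _
    exact_mod_cast this
  rcases le_total (B.card : ℝ) (q ^ 2) with hc | hc
  · nlinarith
  have hb0 : b ≠ 0 := fun h => by simpa [h] using hB b hb b hb
  have hB0 : ∀ x ∈ B, x ≠ 0 := fun x hx h => by simpa [h] using hB x hx x hx
  -- Scaling by α b makes every slope α²bx positive, as the incidence bound requires.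
  set σ : ℝ := α * b with hσ
  have hσ0 : σ ≠ 0 := mul_ne_zero hα hb0
  set L : Finset (ℝ × ℝ) := (B ×ˢ B).image fun p => (σ * (α * p.1), σ * (β * p.2)) with hLdef
  have hLcard : (L.card : ℝ) ≤ B.card * B.card := by
    have : L.card ≤ B.card * B.card := by
      rw [← Finset.card_product]; exact Finset.card_image_le
    exact_mod_cast this
  have hLpos : ∀ l ∈ L, 0 < l.1 := by
    intro l hl
    obtain ⟨⟨x, y⟩, hp, rfl⟩ := Finset.mem_image.1 hl
    have := hB b hb x (Finset.mem_product.1 hp).1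
    have h2 : 0 < α ^ 2 := by positivity
    have h3 : σ * (α * x) = α ^ 2 * (b * x) := by rw [hσ]; ring
    simp only [h3]
    positivity
  set V := B.image (σ * ·) with hV
  have hVcard : (V.card : ℝ) ≤ B.card := by exact_mod_cast Finset.card_image_le
  -- These cell sizes balance all the main terms at |B|²q².
  have hinc := card_incidences_le (B / B) V L hLpos (s := ⌈q⌉₊) (t := ⌈B.card / q ^ 2⌉₊)
    (Nat.ceil_pos.2 (by positivity)) (Nat.ceil_pos.2 (by positivity))
  -- A solution (x, y) gives one incidence for each c in B: the line with parameters (σαc, σβy)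
  -- takes the value σ(αx + βy) at x/c.
  have hlow : B.card * T.card ≤
      ((L ×ˢ (B / B)).filter fun p => p.1.1 * p.2 + p.1.2 ∈ V).card := by
    rw [← Finset.card_product]
    refine Finset.card_le_card_of_injOn
      (fun p => ((σ * (α * p.1), σ * (β * p.2.2)), p.2.1 / p.1)) ?_ ?_
    · rintro ⟨c, x, y⟩ hp
      simp only [hT, Finset.coe_product, Finset.coe_filter, Finset.mem_product, Set.mem_prod,
        Finset.mem_coe, Set.mem_ofPred_eq] at hp
      obtain ⟨hc, ⟨hx, hy⟩, hxy⟩ := hp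
      have hc0 := hB0 c hc
      simp only [Finset.coe_filter, Finset.mem_product, Set.mem_ofPred_eq]
      refine ⟨⟨Finset.mem_image.2 ⟨(c, y), Finset.mem_product.2 ⟨hc, hy⟩, rfl⟩,
        Finset.div_mem_div hx hc⟩, Finset.mem_image.2 ⟨_, hxy, ?_⟩⟩
      field_simp
    · rintro ⟨c, x, y⟩ hp ⟨c', x', y'⟩ hp' heq
      simp only [Finset.coe_product, Set.mem_prod, Finset.mem_coe] at hp
      have hc0 := hB0 c hp.1
      simp only [Prod.mk.injEq] at heq
      obtain ⟨⟨e1, e2⟩, e3⟩ := heq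
      have e1 := mul_left_cancel₀ hα (mul_left_cancel₀ hσ0 e1)
      have e2 := mul_left_cancel₀ hβ (mul_left_cancel₀ hσ0 e2)
      subst e1 e2
      have := (div_left_inj' hc0).1 e3
      subst this
      rfl
  have hs1 : (⌈q⌉₊ : ℝ) ≤ 2 * q := by
    have := (Nat.ceil_lt_add_one (by positivity : 0 ≤ q)).le; linarith
  have h1 : 1 ≤ (B.card : ℝ) / q ^ 2 := (one_le_div (by positivity)).2 hc
  have ht1 : (⌈(B.card : ℝ) / q ^ 2⌉₊ : ℝ) ≤ 2 * (B.card / q ^ 2) := by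
    have := (Nat.ceil_lt_add_one (by positivity : 0 ≤ (B.card : ℝ) / q ^ 2)).le
    linarith
  have hd1 : (((B / B).card / ⌈q⌉₊ : ℕ) : ℝ) ≤ q ^ 2 := by
    refine Nat.cast_div_le.trans ?_
    rw [div_le_iff₀ (by exact_mod_cast Nat.ceil_pos.2 (by positivity))]
    have := Nat.le_ceil q
    nlinarith [sq_nonneg q]
  have hd2 : ((V.card / ⌈(B.card : ℝ) / q ^ 2⌉₊ : ℕ) : ℝ) ≤ q ^ 2 := by
    refine Nat.cast_div_le.trans ?_
    rw [div_le_iff₀ (by exact_mod_cast Nat.ceil_pos.2 (by positivity))]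
    have h3 := Nat.le_ceil ((B.card : ℝ) / q ^ 2)
    rw [div_le_iff₀ (by positivity)] at h3
    linarith
  have hfin : (B.card : ℝ) * T.card ≤ B.card * (8 * B.card * q ^ 2) := by
    have h4 : (B.card : ℝ) * T.card ≤ L.card * (((B / B).card / ⌈q⌉₊ : ℕ) +
        (V.card / ⌈(B.card : ℝ) / q ^ 2⌉₊ : ℕ) + 1) +
        (B / B).card * V.card * (⌈q⌉₊ * ⌈(B.card : ℝ) / q ^ 2⌉₊) := by
      exact_mod_cast hlow.trans hinc
    have h5 : (L.card : ℝ) * (((B / B).card / ⌈q⌉₊ : ℕ) +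
        (V.card / ⌈(B.card : ℝ) / q ^ 2⌉₊ : ℕ) + 1) ≤
        (B.card * B.card) * (q ^ 2 + q ^ 2 + q ^ 2) := by
      gcongr
      nlinarith
    have h6 : ((B / B).card : ℝ) * V.card * (⌈q⌉₊ * ⌈(B.card : ℝ) / q ^ 2⌉₊) ≤
        q ^ 3 * B.card * ((2 * q) * (2 * (B.card / q ^ 2))) := by
      gcongr
    have h7 : q ^ 3 * B.card * ((2 * q) * (2 * (B.card / q ^ 2))) =
        4 * (B.card * B.card * q ^ 2) := by
      field_simp
      ring
    have : 0 ≤ (B.card : ℝ) * B.card * q ^ 2 := by positivity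
    nlinarith
  exact le_of_mul_le_mul_left hfin hn

/-! ### Sums along two slopes and their overlaps -/

/-- The sums of a multiple of the vector of slope `u` and abscissa `b u` and a multiple of the one
of slope `v`, with coefficients from `B`. -/
noncomputable def slopeSums (B : Finset ℝ) (b : ℝ → ℝ) (u v : ℝ) : Finset (ℝ × ℝ) :=
  (B ×ˢ B).image fun p => (p.1 * b u + p.2 * b v, p.1 * (b u * u) + p.2 * (b v * v))

theorem slopeSums_comm (B : Finset ℝ) (b : ℝ → ℝ) (u v : ℝ) :
    slopeSums B b u v = slopeSums B b v u := by
  have key : ∀ u v, slopeSums B b u v ⊆ slopeSums B b v u := by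
    intro u v z hz
    obtain ⟨⟨x, y⟩, hp, rfl⟩ := Finset.mem_image.1 hz
    rw [Finset.mem_product] at hp
    exact Finset.mem_image.2 ⟨(y, x), Finset.mem_product.2 ⟨hp.2, hp.1⟩,
      Prod.ext (add_comm _ _) (add_comm _ _)⟩
  exact (key u v).antisymm (key v u)

theorem card_slopeSums (B : Finset ℝ) (b : ℝ → ℝ) {u v : ℝ} (huv : u ≠ v) (hu : b u ≠ 0)
    (hv : b v ≠ 0) : (slopeSums B b u v).card = B.card * B.card := by
  rw [slopeSums, Finset.card_image_of_injective, Finset.card_product]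
  rintro ⟨x, y⟩ ⟨x', y'⟩ h
  simp only [Prod.mk.injEq] at h ⊢
  obtain ⟨h1, h2⟩ := h
  have hx : (x - x') * (b u * (u - v)) = 0 := by linear_combination h2 - v * h1
  have hy : (y - y') * (b v * (v - u)) = 0 := by linear_combination h2 - u * h1
  have huv' := sub_ne_zero.2 huv
  have hvu' := sub_ne_zero.2 huv.symm
  constructor
  · exact sub_eq_zero.1 ((mul_eq_zero.1 hx).resolve_right (mul_ne_zero hu huv'))
  · exact sub_eq_zero.1 ((mul_eq_zero.1 hy).resolve_right (mul_ne_zero hv hvu'))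

/-- The functional (X, Y) ↦ Y − zX kills the vector of slope z, so a common point yields a linear
equation among the other three coefficients, nondegenerate because z differs from u, v, w. -/
theorem card_slopeSums_inter_le_aux (B : Finset ℝ) (hB : ∀ x ∈ B, ∀ y ∈ B, 0 < x * y)
    {q : ℝ} (hq : 1 ≤ q) (hQ : ((B / B).card : ℝ) ≤ q ^ 3) (b : ℝ → ℝ) {u v w z : ℝ}
    (hu : b u ≠ 0) (hv : b v ≠ 0) (hw : b w ≠ 0) (huz : u ≠ z) (hvz : v ≠ z) (hwz : w ≠ z) :
    (((slopeSums B b u v ∩ slopeSums B b w z).card : ℕ) : ℝ) ≤ 8 * B.card * q ^ 2 := by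
  have hu' := mul_ne_zero hu (sub_ne_zero.2 huz)
  have hv' := mul_ne_zero hv (sub_ne_zero.2 hvz)
  have hw' := mul_ne_zero hw (sub_ne_zero.2 hwz)
  refine le_trans ?_ (card_linear_solutions_le B hB (div_ne_zero hu' hw') (div_ne_zero hv' hw')
    hq hQ)
  rw [Nat.cast_le]
  refine (Finset.card_le_card (t := Finset.image (fun p : ℝ × ℝ =>
    (p.1 * b u + p.2 * b v, p.1 * (b u * u) + p.2 * (b v * v))) _) ?_).trans
    Finset.card_image_le
  intro s hs
  obtain ⟨hs1, hs2⟩ := Finset.mem_inter.1 hs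
  obtain ⟨⟨x, y⟩, hp, rfl⟩ := Finset.mem_image.1 hs1
  obtain ⟨⟨x', y'⟩, hp', h⟩ := Finset.mem_image.1 hs2
  refine Finset.mem_image.2 ⟨(x, y), Finset.mem_filter.2 ⟨hp, ?_⟩, rfl⟩
  simp only [Prod.mk.injEq] at h
  have : b u * (u - z) / (b w * (w - z)) * x + b v * (v - z) / (b w * (w - z)) * y = x' := by
    rw [div_mul_eq_mul_div, div_mul_eq_mul_div, ← add_div, div_eq_iff hw']
    linear_combination z * h.1 - h.2
  simp only [this]
  exact (Finset.mem_product.1 hp').1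

/-- Two different increasing pairs share at most one slope, so z or w lies outside {u, v} and can be
eliminated. -/
theorem card_slopeSums_inter_le (B : Finset ℝ) (hB : ∀ x ∈ B, ∀ y ∈ B, 0 < x * y)
    {q : ℝ} (hq : 1 ≤ q) (hQ : ((B / B).card : ℝ) ≤ q ^ 3) (b : ℝ → ℝ) {u v w z : ℝ}
    (hu : b u ≠ 0) (hv : b v ≠ 0) (hw : b w ≠ 0) (hz : b z ≠ 0) (huv : u < v) (hwz : w < z)
    (hne : (u, v) ≠ (w, z)) :
    (((slopeSums B b u v ∩ slopeSums B b w z).card : ℕ) : ℝ) ≤ 8 * B.card * q ^ 2 := by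
  by_cases h : u ≠ z ∧ v ≠ z
  · exact card_slopeSums_inter_le_aux B hB hq hQ b hu hv hw h.1 h.2 hwz.ne
  · have h' : u ≠ w ∧ v ≠ w := by
      constructor
      · rintro rfl
        rw [not_and_or, not_not, not_not] at h
        rcases h with rfl | rfl
        · exact hwz.false
        · exact hne rfl
      · rintro rfl
        rw [not_and_or, not_not, not_not] at h
        rcases h with rfl | rfl
        · exact (huv.trans hwz).false
        · exact hwz.false
    rw [slopeSums_comm B b w z]
    exact card_slopeSums_inter_le_aux B hB hq hQ b hu hv hz h'.1 h'.2 hwz.ne'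

/-- A lower bound for a union of sets of equal size with small pairwise intersections. -/
theorem sq_le_card_biUnion_mul {ι α : Type*} [DecidableEq ι] [DecidableEq α] (I : Finset ι)
    (S : ι → Finset α) {M X : ℝ} (hM : ∀ i ∈ I, ((S i).card : ℝ) = M)
    (hX : ∀ i ∈ I, ∀ j ∈ I, i ≠ j → (((S i ∩ S j).card : ℕ) : ℝ) ≤ X) :
    (I.card * M) ^ 2 ≤ (I.biUnion S).card * (I.card * (M + (I.card - 1) * X)) := by
  set W := I.biUnion S with hW
  have hsub : ∀ i ∈ I, S i ⊆ W := fun i hi => Finset.subset_biUnion_of_mem S hi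
  have hind : ∀ T ⊆ W, (T.card : ℝ) = ∑ z ∈ W, if z ∈ T then (1 : ℝ) else 0 := by
    intro T hT
    rw [Finset.sum_ite_mem, Finset.inter_eq_right.2 hT]
    simp
  have h1 : (I.card : ℝ) * M = ∑ z ∈ W, ∑ i ∈ I, if z ∈ S i then (1 : ℝ) else 0 := by
    rw [Finset.sum_comm, ← nsmul_eq_mul, ← Finset.sum_const]
    exact Finset.sum_congr rfl fun i hi => by rw [← hM i hi, hind _ (hsub i hi)]
  have h2 : ∑ z ∈ W, (∑ i ∈ I, if z ∈ S i then (1 : ℝ) else 0) ^ 2 =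
      ∑ i ∈ I, ∑ j ∈ I, ((S i ∩ S j).card : ℝ) := by
    simp_rw [sq, Finset.sum_mul_sum]
    rw [Finset.sum_comm]
    refine Finset.sum_congr rfl fun i hi => ?_
    rw [Finset.sum_comm]
    refine Finset.sum_congr rfl fun j _ => ?_
    rw [hind _ (Finset.inter_subset_left.trans (hsub i hi))]
    refine Finset.sum_congr rfl fun z _ => ?_
    by_cases hi : z ∈ S i <;> by_cases hj : z ∈ S j <;> simp [hi, hj]
  have h3 : ∑ i ∈ I, ∑ j ∈ I, ((S i ∩ S j).card : ℝ) ≤ I.card * (M + (I.card - 1) * X) := by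
    rw [← nsmul_eq_mul, ← Finset.sum_const]
    refine Finset.sum_le_sum fun i hi => ?_
    rw [← Finset.add_sum_erase I _ hi, Finset.inter_self, hM i hi]
    refine add_le_add_right ?_ M
    refine (Finset.sum_le_card_nsmul _ _ X fun j hj => ?_).trans ?_
    · rw [Finset.mem_erase] at hj
      exact hX i hi j hj.2 hj.1.symm
    · rw [nsmul_eq_mul, Finset.card_erase_of_mem hi,
        Nat.cast_pred (Finset.card_pos.2 ⟨i, hi⟩)]
  rw [h1]
  refine sq_sum_le_card_mul_sum_sq.trans ?_
  rw [h2]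
  gcongr

theorem two_mul_card_lt_pairs (K : Finset ℝ) :
    2 * ((K ×ˢ K).filter fun p => p.1 < p.2).card = K.card * K.card - K.card := by
  rw [← Finset.offDiag_card, two_mul]
  have h : ((K ×ˢ K).filter fun p => p.1 < p.2).card =
      ((K ×ˢ K).filter fun p => p.2 < p.1).card := by
    refine Finset.card_bij' (fun p _ => p.swap) (fun p _ => p.swap) ?_ ?_ ?_ ?_ <;>
      simp +contextual
  nth_rewrite 2 [h]
  rw [← Finset.card_union_of_disjoint]
  · congr 1
    ext ⟨x, y⟩
    simp only [Finset.mem_union, Finset.mem_filter, Finset.mem_product, Finset.mem_offDiag,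
      ← and_or_left, and_assoc, lt_or_lt_iff_ne]
  · refine Finset.disjoint_left.2 fun p hp hp' => ?_
    exact ((Finset.mem_filter.1 hp).2.trans (Finset.mem_filter.1 hp').2).false

/-! ### Clusters of slopes -/

/-- All `slopeSums` for two distinct slopes from `K`. -/
noncomputable def clusterSums (B : Finset ℝ) (b : ℝ → ℝ) (K : Finset ℝ) : Finset (ℝ × ℝ) :=
  ((K ×ˢ K).filter fun p => p.1 < p.2).biUnion fun p => slopeSums B b p.1 p.2

theorem le_card_clusterSums (B : Finset ℝ) (hB : ∀ x ∈ B, ∀ y ∈ B, 0 < x * y)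
    (hBne : B.Nonempty) {q : ℝ} (hq : 1 ≤ q) (hQ : ((B / B).card : ℝ) ≤ q ^ 3) (b : ℝ → ℝ)
    (K : Finset ℝ) (hK : ∀ u ∈ K, b u ≠ 0) (h2 : 2 ≤ K.card)
    (hN : K.card = 2 ∨ (K.card : ℝ) ^ 2 * q ^ 2 ≤ 9 * B.card) :
    (K.card : ℝ) ^ 2 * (B.card : ℝ) ^ 2 ≤ 148 * (clusterSums B b K).card := by
  set I := (K ×ˢ K).filter fun p => p.1 < p.2 with hI
  have hk := two_mul_card_lt_pairs K
  rw [← hI] at hk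
  have hkR : 2 * (I.card : ℝ) = (K.card : ℝ) * K.card - K.card := by
    have : 2 * I.card + K.card = K.card * K.card := by
      rw [hk]; exact Nat.sub_add_cancel (by nlinarith)
    have : 2 * (I.card : ℝ) + K.card = (K.card : ℝ) * K.card := by exact_mod_cast this
    linarith
  have h2R : (2 : ℝ) ≤ K.card := by exact_mod_cast h2
  have hn : (0 : ℝ) < B.card := by exact_mod_cast hBne.card_pos
  have hkpos : (0 : ℝ) < I.card := by nlinarith
  have hmem : ∀ i ∈ I, i.1 ∈ K ∧ i.2 ∈ K ∧ i.1 < i.2 := fun i hi => by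
    simpa only [hI, Finset.mem_filter, Finset.mem_product, and_assoc] using hi
  have key := sq_le_card_biUnion_mul I (fun p => slopeSums B b p.1 p.2)
    (M := (B.card : ℝ) ^ 2) (X := 8 * B.card * q ^ 2)
    (fun i hi => by
      obtain ⟨h1, h2, h3⟩ := hmem i hi
      rw [card_slopeSums B b h3.ne (hK _ h1) (hK _ h2)]
      push_cast
      ring)
    (fun i hi j hj hij => by
      obtain ⟨h1, h2, h3⟩ := hmem i hi
      obtain ⟨h1', h2', h3'⟩ := hmem j hj
      exact card_slopeSums_inter_le B hB hq hQ b (hK _ h1) (hK _ h2) (hK _ h1') (hK _ h2')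
        h3 h3' hij)
  change _ ≤ ((clusterSums B b K).card : ℝ) * _ at key
  -- Two slopes form a single pair, so there is no overlap; this covers q² large compared with |B|.
  have hX : ((I.card : ℝ) - 1) * (8 * B.card * q ^ 2) ≤ 36 * (B.card : ℝ) ^ 2 := by
    rcases hN with hN | hN
    · rw [hN] at hkR
      have : (I.card : ℝ) = 1 := by norm_num at hkR; exact_mod_cast hkR
      rw [this]
      nlinarith
    · have h3 : ((I.card : ℝ) - 1) ≤ (K.card : ℝ) ^ 2 / 2 := by nlinarith
      calc ((I.card : ℝ) - 1) * (8 * B.card * q ^ 2)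
          ≤ ((K.card : ℝ) ^ 2 / 2) * (8 * B.card * q ^ 2) := by gcongr
        _ = 4 * B.card * ((K.card : ℝ) ^ 2 * q ^ 2) := by ring
        _ ≤ 4 * B.card * (9 * B.card) := by gcongr
        _ = _ := by ring
  have h5 : (I.card * (B.card : ℝ) ^ 2) * (I.card * (B.card : ℝ) ^ 2) ≤
      (37 * (clusterSums B b K).card) * (I.card * (B.card : ℝ) ^ 2) := by
    calc (I.card * (B.card : ℝ) ^ 2) * (I.card * (B.card : ℝ) ^ 2)
        = (I.card * (B.card : ℝ) ^ 2) ^ 2 := by ring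
      _ ≤ _ := key
      _ ≤ (clusterSums B b K).card * (I.card * ((B.card : ℝ) ^ 2 + 36 * (B.card : ℝ) ^ 2)) := by
        gcongr
      _ = _ := by ring
  have h6 := le_of_mul_le_mul_right h5 (by positivity)
  have h7 : (K.card : ℝ) ^ 2 ≤ 4 * I.card := by nlinarith
  nlinarith [mul_le_mul_of_nonneg_right h7 (sq_nonneg (B.card : ℝ))]

/-- The sign conditions give both abscissae the same sign, so the slope of the sum is a proper
convex combination of the two slopes. This separates clusters into sectors. -/
theorem slope_mem_of_mem_clusterSums {B : Finset ℝ} {b : ℝ → ℝ} {K : Finset ℝ}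
    (hB : ∀ x ∈ B, ∀ y ∈ B, 0 < x * y) (hK : ∀ u ∈ K, ∀ v ∈ K, 0 < b u * b v)
    {z : ℝ × ℝ} (hz : z ∈ clusterSums B b K) :
    ∃ u ∈ K, ∃ v ∈ K, u < z.2 / z.1 ∧ z.2 / z.1 < v := by
  obtain ⟨⟨u, v⟩, huv, hz⟩ := Finset.mem_biUnion.1 hz
  simp only [Finset.mem_filter, Finset.mem_product] at huv
  obtain ⟨⟨hu, hv⟩, huv⟩ := huv
  obtain ⟨⟨x, y⟩, hp, rfl⟩ := Finset.mem_image.1 hz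
  rw [Finset.mem_product] at hp
  obtain ⟨hx, hy⟩ := hp
  simp only at hx hy
  refine ⟨u, hu, v, hv, ?_⟩
  set s := x * b u with hs
  set t := y * b v with ht
  have hst : 0 < s * t := by
    have := mul_pos (hB x hx y hy) (hK u hu v hv)
    have e : s * t = x * y * (b u * b v) := by rw [hs, ht]; ring
    rwa [e]
  have e : x * (b u * u) + y * (b v * v) = s * u + t * v := by rw [hs, ht]; ring
  simp only [e]
  have hst0 : s + t ≠ 0 := fun h => by
    rw [eq_neg_of_add_eq_zero_left h] at hst
    nlinarith [sq_nonneg t]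
  have h1 : (s * u + t * v) / (s + t) - u = t * (v - u) / (s + t) := by
    field_simp
    ring
  have h2 : v - (s * u + t * v) / (s + t) = s * (v - u) / (s + t) := by
    field_simp
    ring
  have hd := sub_pos.2 huv
  rw [← sub_pos, h1, ← sub_pos (b := (s * u + t * v) / (s + t)), h2]
  rcases pos_and_pos_or_neg_and_neg_of_mul_pos hst with ⟨ha, hb⟩ | ⟨ha, hb⟩
  · exact ⟨by positivity, by positivity⟩
  · exact ⟨div_pos_of_neg_of_neg (by nlinarith) (by linarith),
      div_pos_of_neg_of_neg (by nlinarith) (by linarith)⟩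

/-- Sums over many clusters of consecutive slopes, which lie in disjoint sectors. -/
theorem le_card_sums (B : Finset ℝ) (hB : ∀ x ∈ B, ∀ y ∈ B, 0 < x * y) (hBne : B.Nonempty)
    {q : ℝ} (hq : 1 ≤ q) (hQ : ((B / B).card : ℝ) ≤ q ^ 3) (b : ℝ → ℝ) (R : Finset ℝ)
    (hR : ∀ u ∈ R, ∀ v ∈ R, 0 < b u * b v) {N : ℕ} (h2 : 2 ≤ N)
    (hN : N = 2 ∨ (N : ℝ) ^ 2 * q ^ 2 ≤ 9 * B.card) :
    ((R.card / N : ℕ) : ℝ) * ((N : ℝ) ^ 2 * (B.card : ℝ) ^ 2) ≤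
      148 * (clusterSums B b R).card := by
  set K : ℕ → Finset ℝ := fun j => R.filter fun v => rankIn R v / N = j with hKdef
  have hKR : ∀ j, K j ⊆ R := fun j => Finset.filter_subset _ _
  have hNpos : 0 < N := by omega
  have hR0 : ∀ u ∈ R, b u ≠ 0 := fun u hu h => by simpa [h] using hR u hu u hu
  have hcard : ∀ j < R.card / N, (K j).card = N := fun j hj => card_block_eq R hNpos hj
  have hdisj : ∀ i j, i < j → Disjoint (clusterSums B b (K i)) (clusterSums B b (K j)) := by
    intro i j hij
    refine Finset.disjoint_left.2 fun z hz hz' => ?_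
    obtain ⟨-, -, v, hv, -, hzv⟩ := slope_mem_of_mem_clusterSums hB
      (fun u hu v hv => hR u (hKR i hu) v (hKR i hv)) hz
    obtain ⟨u, hu, -, -, hzu, -⟩ := slope_mem_of_mem_clusterSums hB
      (fun u hu v hv => hR u (hKR j hu) v (hKR j hv)) hz'
    have huv := hzu.trans hzv
    have h1 : rankIn R u / N ≤ rankIn R v / N := Nat.div_le_div_right (rankIn_mono R huv.le)
    rw [(Finset.mem_filter.1 hv).2, (Finset.mem_filter.1 hu).2] at h1
    omega
  have hsub : ((Finset.range (R.card / N)).biUnion fun j => clusterSums B b (K j)) ⊆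
      clusterSums B b R := by
    refine Finset.biUnion_subset.2 fun j _ => ?_
    exact Finset.biUnion_subset_biUnion_of_subset_left _
      (Finset.filter_subset_filter _ (Finset.product_subset_product (hKR j) (hKR j)))
  have hle := Finset.card_le_card hsub
  rw [Finset.card_biUnion] at hle
  · calc ((R.card / N : ℕ) : ℝ) * ((N : ℝ) ^ 2 * (B.card : ℝ) ^ 2)
        = ∑ j ∈ Finset.range (R.card / N), ((N : ℝ) ^ 2 * (B.card : ℝ) ^ 2) := by simp
      _ ≤ ∑ j ∈ Finset.range (R.card / N), 148 * ((clusterSums B b (K j)).card : ℝ) := by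
        refine Finset.sum_le_sum fun j hj => ?_
        have hc := hcard j (Finset.mem_range.1 hj)
        have := le_card_clusterSums B hB hBne hq hQ b (K j) (fun u hu => hR0 u (hKR j hu))
          (by rw [hc]; exact h2) (by rw [hc]; exact hN)
        rwa [hc] at this
      _ ≤ _ := by
        rw [← Finset.mul_sum]
        gcongr
        exact_mod_cast hle
  · intro i _ j _ hij
    rcases lt_or_gt_of_ne hij with h | h
    · exact hdisj i j h
    · exact (hdisj j i h).symm

/-! ### Choice of signs, of cluster size, and conclusion -/

theorem exists_same_sign (S : Finset ℝ) (f : ℝ → ℝ) (hf : ∀ x ∈ S, f x ≠ 0) :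
    ∃ T ⊆ S, S.card ≤ 2 * T.card ∧ ∀ x ∈ T, ∀ y ∈ T, 0 < f x * f y := by
  have h := Finset.card_filter_add_card_filter_not (s := S) (fun x => 0 < f x)
  rcases le_total (S.filter fun x => 0 < f x).card (S.filter fun x => ¬ 0 < f x).card with hc | hc
  · refine ⟨_, Finset.filter_subset (fun x => ¬ 0 < f x) S, by omega, fun x hx y hy => ?_⟩
    rw [Finset.mem_filter, not_lt] at hx hy
    exact mul_pos_of_neg_of_neg (lt_of_le_of_ne hx.2 (hf x hx.1))
      (lt_of_le_of_ne hy.2 (hf y hy.1))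
  · refine ⟨_, Finset.filter_subset (fun x => 0 < f x) S, by omega, fun x hx y hy => ?_⟩
    rw [Finset.mem_filter] at hx hy
    exact mul_pos hx.2 hy.2

theorem clusterSums_subset {A B R : Finset ℝ} {b : ℝ → ℝ} (hBA : B ⊆ A)
    (hb : ∀ u ∈ R, b u ∈ A ∧ b u * u ∈ A) :
    clusterSums B b R ⊆ (A * A + A * A) ×ˢ (A * A + A * A) := by
  intro z hz
  obtain ⟨⟨u, v⟩, huv, hz⟩ := Finset.mem_biUnion.1 hz
  simp only [Finset.mem_filter, Finset.mem_product] at huv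
  obtain ⟨⟨hu, hv⟩, -⟩ := huv
  obtain ⟨⟨x, y⟩, hp, rfl⟩ := Finset.mem_image.1 hz
  rw [Finset.mem_product] at hp
  have hx := hBA hp.1
  have hy := hBA hp.2
  exact Finset.mem_product.2
    ⟨Finset.add_mem_add (Finset.mul_mem_mul hx (hb u hu).1) (Finset.mul_mem_mul hy (hb v hv).1),
     Finset.add_mem_add (Finset.mul_mem_mul hx (hb u hu).2) (Finset.mul_mem_mul hy (hb v hv).2)⟩

/-- `le_card_sums` for clusters of the optimal size. -/
theorem le_card_sums_of_roots (B : Finset ℝ) (hB : ∀ x ∈ B, ∀ y ∈ B, 0 < x * y)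
    {q : ℝ} (hq1 : 1 ≤ q) (hBB : ((B / B).card : ℝ) ≤ q ^ 3) (b : ℝ → ℝ) (R : Finset ℝ)
    (hR : ∀ u ∈ R, ∀ v ∈ R, 0 < b u * b v) (hRm : q ^ 3 ≤ 2 * R.card)
    (hBq : (B.card : ℝ) ≤ q ^ 3) (hb16 : (16 : ℝ) ≤ B.card) :
    q ^ 2 * √(B.card : ℝ) * (B.card : ℝ) ^ 2 ≤ 592 * (clusterSums B b R).card := by
  have hq : 0 < q := by linarith
  have hBne : B.Nonempty := Finset.card_pos.1 (by
    have : (0 : ℝ) < B.card := by linarith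
    exact_mod_cast this)
  set n : ℝ := (B.card : ℝ) with hn
  set r := √n with hr
  have hrr : r ^ 2 = n := Real.sq_sqrt (by positivity)
  have hr4 : 4 ≤ r := Real.le_sqrt_of_sq_le (by linarith)
  -- A cluster needs at least two slopes. If r/q ≥ 1 then N ≤ 3r/q, whence the factor 9; otherwise N
  -- = 2.
  set N := 2 + ⌊r / q⌋₊ with hNdef
  have hfl := Nat.floor_le (show 0 ≤ r / q by positivity)
  have hfl2 := Nat.lt_floor_add_one (r / q)
  have hNlow : r / q ≤ N := by rw [hNdef]; push_cast; linarith
  have hNup : (N : ℝ) ≤ 2 + r / q := by rw [hNdef]; push_cast; linarith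
  have hN : N = 2 ∨ (N : ℝ) ^ 2 * q ^ 2 ≤ 9 * B.card := by
    rcases Nat.eq_zero_or_pos ⌊r / q⌋₊ with h | h
    · left; omega
    · right
      have h1 : 1 ≤ r / q := (Nat.floor_pos).1 h
      rw [← mul_pow, ← hn, ← hrr]
      have h2 : (N : ℝ) * q ≤ 3 * r := by
        calc (N : ℝ) * q ≤ (3 * (r / q)) * q := by gcongr; linarith
          _ = 3 * r := by field_simp
      calc ((N : ℝ) * q) ^ 2 ≤ (3 * r) ^ 2 := by gcongr
        _ = _ := by ring
  have hNR : N ≤ R.card := by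
    have h1 : r / q ≤ r := div_le_self (by positivity) hq1
    have : (N : ℝ) ≤ R.card := by nlinarith
    exact_mod_cast this
  have hNpos : 0 < N := by omega
  have hdiv : (R.card : ℝ) ≤ 2 * ((R.card / N : ℕ) : ℝ) * N := by
    have h1 : 1 ≤ R.card / N := (Nat.one_le_div_iff hNpos).2 hNR
    have h2 := Nat.div_add_mod R.card N
    have h3 := Nat.mod_lt R.card hNpos
    have h4 : R.card ≤ 2 * (R.card / N) * N := by nlinarith
    exact_mod_cast h4
  have hmain := le_card_sums B hB hBne hq1 hBB b R hR (N := N) (by omega) hN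
  have e : q ^ 2 * r = q ^ 3 * (r / q) := by field_simp
  have h5 : q ^ 3 ≤ 4 * ((R.card / N : ℕ) : ℝ) * N := by linarith
  calc q ^ 2 * r * n ^ 2 = q ^ 3 * (r / q) * n ^ 2 := by rw [e]
    _ ≤ (4 * ((R.card / N : ℕ) : ℝ) * N) * N * n ^ 2 := by
      refine mul_le_mul_of_nonneg_right (mul_le_mul h5 hNlow ?_ ?_) ?_ <;> positivity
    _ = 4 * (((R.card / N : ℕ) : ℝ) * ((N : ℝ) ^ 2 * n ^ 2)) := by ring
    _ ≤ 4 * (148 * (clusterSums B b R).card) := mul_le_mul_of_nonneg_left hmain (by norm_num)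
    _ = _ := by ring

/-- The growth estimate, with `a` the fourth root of `|A|` and `q` the cube root of the
number of ratios. -/
theorem growth_of_roots (A : Finset ℝ) (hA : (0 : ℝ) ∉ A) (hne : A.Nonempty) {a q : ℝ}
    (ha : 0 < a) (hq : 0 < q) (haA : a ^ 4 = A.card) (hqA : q ^ 3 = (A / A).card) :
    a ^ 5 * q ≤ 1000 * ((A * A + A * A).card : ℝ) := by
  obtain ⟨a₀, ha₀⟩ := hne
  have hA0 : ∀ x ∈ A, x ≠ 0 := fun x hx h => hA (h ▸ hx)
  have hAQ : A.card ≤ (A / A).card := by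
    refine Finset.card_le_card_of_injOn (fun x => x / a₀)
      (fun x hx => Finset.div_mem_div hx ha₀) fun x _ y _ h => ?_
    exact (div_left_inj' (hA0 a₀ ha₀)).1 h
  have hQA : (A / A).card ≤ A.card * A.card := Finset.card_div_le
  have hA1 : (1 : ℝ) ≤ A.card := by exact_mod_cast Finset.card_pos.2 ⟨a₀, ha₀⟩
  have hAQ' : (A.card : ℝ) ≤ q ^ 3 := by rw [hqA]; exact_mod_cast hAQ
  have hQA' : q ^ 3 ≤ (A.card : ℝ) * A.card := by rw [hqA]; exact_mod_cast hQA
  have hq1 : 1 ≤ q := by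
    by_contra! h
    have : q ^ 3 < 1 := pow_lt_one₀ hq.le h (by norm_num)
    linarith
  set Y : ℝ := ((A * A + A * A).card : ℝ) with hY
  have hY1 : 1 ≤ Y := by
    have hmem : a₀ * a₀ + a₀ * a₀ ∈ A * A + A * A :=
      Finset.add_mem_add (Finset.mul_mem_mul ha₀ ha₀) (Finset.mul_mem_mul ha₀ ha₀)
    rw [hY]
    exact_mod_cast Finset.card_pos.2 ⟨_, hmem⟩
  -- Small sets are handled trivially, and they dictate the constant 1000. From 32 on, |B| ≥ 16,
  -- which ensures that R contains a full cluster.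
  rcases lt_or_ge A.card 32 with hsmall | hbig
  · have hs : (A.card : ℝ) < 32 := by exact_mod_cast hsmall
    have h1 : a ≤ 12 / 5 := le_of_pow_le_pow_left₀ (n := 4) (by norm_num) (by norm_num)
      (by rw [haA]; norm_num; linarith)
    have h2 : q ≤ 51 / 5 := le_of_pow_le_pow_left₀ (n := 3) (by norm_num) (by norm_num)
      (by norm_num; nlinarith)
    calc a ^ 5 * q ≤ (12 / 5) ^ 5 * (51 / 5) := by gcongr
      _ ≤ 1000 * 1 := by norm_num
      _ ≤ _ := by gcongr
  obtain ⟨B, hBA, hBcard, hB⟩ := exists_same_sign A id hA0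
  simp only [id] at hB
  -- The default 0 off the ratio set is harmless: only slopes in `R ⊆ A / A` occur.
  have hex : ∀ u, ∃ x, u ∈ A / A → x ∈ A ∧ x * u ∈ A := by
    intro u
    by_cases hu : u ∈ A / A
    · obtain ⟨y, hy, x, hx, rfl⟩ := Finset.mem_div.1 hu
      exact ⟨x, fun _ => ⟨hx, by rwa [mul_div_cancel₀ _ (hA0 x hx)]⟩⟩
    · exact ⟨0, fun h => absurd h hu⟩
  choose b hb using hex
  obtain ⟨R, hRQ, hRcard, hR⟩ := exists_same_sign (A / A) b fun u hu => hA0 _ (hb u hu).1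
  have hBn : (A.card : ℝ) ≤ 2 * B.card := by exact_mod_cast hBcard
  have hBA' : (B.card : ℝ) ≤ A.card := by exact_mod_cast Finset.card_le_card hBA
  have hRm : q ^ 3 ≤ 2 * R.card := by rw [hqA]; exact_mod_cast hRcard
  have hBB : ((B / B).card : ℝ) ≤ q ^ 3 := by
    rw [hqA]; exact_mod_cast Finset.card_le_card (Finset.div_subset_div hBA hBA)
  have hb16 : (16 : ℝ) ≤ B.card := by
    have : 16 ≤ B.card := by omega
    exact_mod_cast this
  set n : ℝ := (B.card : ℝ) with hn
  set r := √n with hr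
  have hrr : r ^ 2 = n := Real.sq_sqrt (by positivity)
  have hsub : ((clusterSums B b R).card : ℝ) ≤ Y ^ 2 := by
    have := Finset.card_le_card (clusterSums_subset hBA fun u hu => hb u (hRQ hu))
    rw [Finset.card_product] at this
    rw [hY, sq]
    exact_mod_cast this
  have h1 : q ^ 2 * r * n ^ 2 ≤ 592 * Y ^ 2 :=
    (le_card_sums_of_roots B hB hq1 hBB b R hR hRm (hBA'.trans hAQ') hb16).trans (by gcongr)
  have hra : a ^ 2 ≤ 2 * r := by
    refine le_of_pow_le_pow_left₀ (n := 2) (by norm_num) (by positivity) ?_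
    calc (a ^ 2) ^ 2 = a ^ 4 := by ring
      _ ≤ 2 * n := by rw [haA]; exact hBn
      _ ≤ (2 * r) ^ 2 := by rw [mul_pow, hrr]; linarith
  have hna : a ^ 4 ≤ 2 * n := by rw [haA]; exact hBn
  refine le_of_pow_le_pow_left₀ (n := 2) (by norm_num) (by positivity) ?_
  calc (a ^ 5 * q) ^ 2 = q ^ 2 * a ^ 2 * (a ^ 4) ^ 2 := by ring
    _ ≤ q ^ 2 * (2 * r) * (2 * n) ^ 2 := by gcongr
    _ = 8 * (q ^ 2 * r * n ^ 2) := by ring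
    _ ≤ 8 * (592 * Y ^ 2) := by gcongr
    _ ≤ (1000 * Y) ^ 2 := by nlinarith [sq_nonneg Y]

theorem theorem2p2 :
    ∃ c : ℝ, 0 < c ∧ ∀ A : Finset ℝ, (0 : ℝ) ∉ A →
      c * ((A.card : ℝ) ^ (5 / 4 : ℝ) * ((A / A).card : ℝ) ^ (1 / 3 : ℝ))
          ≤ ((A * A + A * A).card : ℝ) ∧
      c * (A.card : ℝ) ^ (19 / 12 : ℝ) ≤ ((A * A + A * A).card : ℝ) := by
  refine ⟨1 / 1000, by norm_num, fun A hA => ?_⟩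
  rcases A.eq_empty_or_nonempty with rfl | hne
  · norm_num
  obtain ⟨a₀, ha₀⟩ := hne
  have hA1 : (0 : ℝ) < A.card := by exact_mod_cast Finset.card_pos.2 ⟨a₀, ha₀⟩
  have ha₀' : a₀ ≠ 0 := fun h => hA (h ▸ ha₀)
  have hAQ : (A.card : ℝ) ≤ (A / A).card := by
    have : A.card ≤ (A / A).card := Finset.card_le_card_of_injOn (fun x => x / a₀)
      (fun x hx => Finset.div_mem_div hx ha₀) fun x _ y _ h => (div_left_inj' ha₀').1 h
    exact_mod_cast this
  have hQ : (0 : ℝ) < (A / A).card := hA1.trans_le hAQ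
  have key := growth_of_roots A hA ⟨a₀, ha₀⟩ (a := (A.card : ℝ) ^ (1 / 4 : ℝ))
    (q := ((A / A).card : ℝ) ^ (1 / 3 : ℝ)) (by positivity) (by positivity)
    (by rw [← Real.rpow_mul_natCast hA1.le]; norm_num)
    (by rw [← Real.rpow_mul_natCast hQ.le]; norm_num)
  rw [← Real.rpow_mul_natCast hA1.le, show (1 / 4 : ℝ) * (5 : ℕ) = 5 / 4 by norm_num] at key
  have h2 : (A.card : ℝ) ^ (19 / 12 : ℝ) ≤
      (A.card : ℝ) ^ (5 / 4 : ℝ) * ((A / A).card : ℝ) ^ (1 / 3 : ℝ) := by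
    rw [show (19 / 12 : ℝ) = 5 / 4 + 1 / 3 by norm_num, Real.rpow_add hA1]
    gcongr
  constructor <;> linarith
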